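/- An algebra $\mathbf A$ consists of a non-empty set $A$ and a (possibly infinite) family of finitary operations on $A$, named by the operation symbols of its language. The length of a term is the number of occurrences of variable and operation symbols in it, so $|x| = 1$ if $x$ is a variable or a nullary operation symbol, and $|f(t_1,\dots,t_k)| = 1 + \sum_{i=1}^k |t_i|$. For $n \ge 1$ let $$\mathrm{Len}_{\mathbf A}(n) = \max_{t}\ \min\{\, |s| : s \text{ is an } n\text{-ary term with } s^{\mathbf A} = t^{\mathbf A} \,\},$$ where $t$ ranges over all $n$-ary terms in the language of $\mathbf A$. $\mathbf A$ is a Mal'cev algebra if it has a ternary term $q$ with $q^{\mathbf A}(x,y,y) = x = q^{\mathbf A}(y,y,x)$ for all $x,y \in A$. For congruences $\alpha_1,\dots,\alpha_{m}$ of $\mathbf A$, where $m \ge 1$, the higher commutator $[\alpha_1,\dots,\alpha_{m}]$ is the smallest congruence $\delta$ of $\mathbf A$ with the following property: for all terms $t$ in $m$ blocks of variables and all tuples $\mathbf a_i, \mathbf b_i$ of the length of the $i$-th block that are componentwise $\alpha_i$-related ($1 \le i \le m$), if $$t^{\mathbf A}(\mathbf x_1,\dots,\mathbf x_{m-1},\mathbf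 a_{m}) \mathrel{\delta} t^{\mathbf A}(\mathbf x_1,\dots,\mathbf x_{m-1},\mathbf b_{m})$$ for all choices of $\mathbf x_i$ between $\mathbf a_i$ and $\mathbf b_i$ ($i < m$) other than choosing $\mathbf b_i$ for every $i < m$, then $$t^{\mathbf A}(\mathbf b_1,\dots,\mathbf b_{m-1},\mathbf a_{m}) \mathrel{\delta} t^{\mathbf A}(\mathbf b_1,\dots,\mathbf b_{m-1},\mathbf b_{m}).$$ $\mathbf A$ is supernilpotent of degree $d$ if the commutator $[1_{\mathbf A},\dots,1_{\mathbf A}]$ of arity $d+1$ equals $0_{\mathbf A}$, where $1_{\mathbf A}$ is the full congruence and $0_{\mathbf A}$ is equality; it is supernilpotent if this holds for some $d \ge 1$. **Theorem.** Let $\mathbf A$ be a finite supernilpotent Mal'cev algebra, possibly with infinitely many basic operations. Then there exist an integer $k > 0$ and a real number $c > 0$ such that $\mathrm{Len}_{\mathbf A}(n) \le c\,n^k$ for all integers $n \ge 1$. -/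

import Mathlib

/-! An algebra is a nonempty type `A` with an `L.Structure A`, where `L` is a first-order language
without relation symbols (`L.IsAlgebraic`) and with arbitrarily many operation symbols.
Terms over `x₁, …, xₙ` are elements of `L.Term (Fin n)`, and `t.realize` is the induced function. -/

universe u v w x

namespace UnivAlg

open FirstOrder FirstOrder.Language

section Length

variable {L : FirstOrder.Language.{u, v}}

/-- The length of a term: the number of occurrences of variable and operation symbols in it. -/
def termLength {X : Type x} : L.Term X → ℕ
  | .var _ => 1
  | .func _ ts => 1 + ∑ i, termLength (ts i)

variable (L) (A : Type w) [L.Structure A]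

/-- The term function `t^A : A^n → A`. -/
def termFun {n : ℕ} (t : L.Term (Fin n)) : (Fin n → A) → A := fun a => t.realize a

variable {A} in
/-- The length of a term function `f`: the length of a shortest term inducing `f`. -/
noncomputable def funLength {n : ℕ} (f : (Fin n → A) → A) : ℕ :=
  sInf {m | ∃ s : L.Term (Fin n), termFun L A s = f ∧ termLength s = m}

/-- `Len_A(n)`: the maximal length of an `n`-ary term function of `A`. -/
noncomputable def Len (n : ℕ) : ℕ :=
  sSup {m | ∃ t : L.Term (Fin n), funLength L (termFun L A t) = m}

/-- The minimum in `funLength` is attained for every term function. -/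
theorem funLength_isLeast {n : ℕ} (t : L.Term (Fin n)) :
    IsLeast {m | ∃ s : L.Term (Fin n), termFun L A s = termFun L A t ∧ termLength s = m}
      (funLength L (termFun L A t)) :=
  ⟨Nat.sInf_mem (s := {m | ∃ s : L.Term (Fin n), termFun L A s = termFun L A t ∧
    termLength s = m}) ⟨_, t, rfl, rfl⟩, fun _ h => Nat.sInf_le h⟩

/-- On a finite algebra, the maximum in `Len` is attained for every `n > 0`. -/
theorem Len_isGreatest [Finite A] {n : ℕ} (hn : 0 < n) :
    IsGreatest {m | ∃ t : L.Term (Fin n), funLength L (termFun L A t) = m} (Len L A n) := by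
  have hfin : {m | ∃ t : L.Term (Fin n), funLength L (termFun L A t) = m}.Finite := by
    refine (Set.finite_range (fun f : (Fin n → A) → A => funLength L f)).subset ?_
    rintro m ⟨t, rfl⟩
    exact ⟨_, rfl⟩
  have hne : {m | ∃ t : L.Term (Fin n), funLength L (termFun L A t) = m}.Nonempty :=
    ⟨_, .var ⟨0, hn⟩, rfl⟩
  exact ⟨Nat.sSup_mem hne hfin.bddAbove, fun m hm => le_csSup hfin.bddAbove hm⟩

end Length

section Commutator

variable (L : FirstOrder.Language.{u, v}) (A : Type w) [L.Structure A]

/-- A congruence of the algebra `A`. -/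
structure Congruence extends Setoid A where
  compat : ∀ {l : ℕ} (f : L.Functions l) (a b : Fin l → A),
    (∀ i, r (a i) (b i)) → r (Structure.funMap f a) (Structure.funMap f b)

/-- The full congruence `1_A`. -/
def oneCong : Congruence L A where
  toSetoid := ⊤
  compat _ _ _ _ := trivial

/-- The equality congruence `0_A`. -/
def zeroCong : Congruence L A where
  toSetoid := ⊥
  compat f _ _ h := congrArg (Structure.funMap f) (funext h)

variable {L A}

/-- The arguments `(x_0, …, x_n)` of a term whose variables are split into `n + 1` blocks,
where the `i`-th block `x_i` is `b i` if `s i` is true and `a i` otherwise. -/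
def mix {n : ℕ} {k : Fin (n + 1) → ℕ} (a b : (i : Fin (n + 1)) → Fin (k i) → A)
    (s : Fin (n + 1) → Bool) : (Σ i, Fin (k i)) → A :=
  fun p => if s p.1 then b p.1 p.2 else a p.1 p.2

/-- The centralizing relation of the higher commutator: `α 0, …, α (n - 1)` centralize `α n`
modulo `δ`. Here `Fin.snoc s false` and `Fin.snoc s true` put `a n` respectively `b n` into the
last block, and make the choice `s` between `a i` and `b i` in the first `n` blocks. -/
def Centralizes {n : ℕ} (α : Fin (n + 1) → Congruence L A) (δ : Congruence L A) : Prop :=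
  ∀ (k : Fin (n + 1) → ℕ) (t : L.Term (Σ i, Fin (k i)))
    (a b : (i : Fin (n + 1)) → Fin (k i) → A),
    (∀ i j, (α i).r (a i j) (b i j)) →
    (∀ s : Fin n → Bool, s ≠ (fun _ => true) →
      δ.r (t.realize (mix a b (Fin.snoc (α := fun _ => Bool) s false)))
        (t.realize (mix a b (Fin.snoc (α := fun _ => Bool) s true)))) →
    δ.r (t.realize (mix a b (Fin.snoc (α := fun _ => Bool) (fun _ => true) false)))
      (t.realize (mix a b (Fin.snoc (α := fun _ => Bool) (fun _ => true) true)))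

/-- The higher commutator `[α 0, …, α n]` of arity `n + 1`: the smallest congruence `δ` such that
`α 0, …, α (n - 1)` centralize `α n` modulo `δ`, given as the intersection of all of them. -/
def commutator {n : ℕ} (α : Fin (n + 1) → Congruence L A) : Congruence L A where
  r x y := ∀ δ : Congruence L A, Centralizes α δ → δ.r x y
  iseqv :=
    ⟨fun x δ _ => δ.iseqv.refl x, fun h δ hδ => δ.iseqv.symm (h δ hδ),
      fun h h' δ hδ => δ.iseqv.trans (h δ hδ) (h' δ hδ)⟩
  compat f a b h δ hδ := δ.compat f a b fun i => h i δ hδ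

/-- The intersection defining the commutator is itself one of the intersected congruences. -/
theorem centralizes_commutator {n : ℕ} (α : Fin (n + 1) → Congruence L A) :
    Centralizes α (commutator α) :=
  fun k t a b hab h δ hδ => hδ k t a b hab fun s hs => h s hs δ hδ

variable (L A)

/-- `A` is supernilpotent of degree `n`: the commutator `[1_A, …, 1_A]` of arity `n + 1`
equals `0_A`. -/
def IsSupernilpotentOfDegree (n : ℕ) : Prop :=
  commutator (fun _ : Fin (n + 1) => oneCong L A) = zeroCong L A

/-- `A` is supernilpotent: it is supernilpotent of some positive degree. -/
def IsSupernilpotent : Prop :=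
  ∃ n : ℕ, 0 < n ∧ IsSupernilpotentOfDegree L A n

/-- `A` is a Mal'cev algebra: there is a ternary term `q` such that `q(x, y, y) = x` and
`q(y, y, x) = x` hold in `A`. -/
def IsMalcev : Prop :=
  ∃ q : L.Term (Fin 3), ∀ x y : A, q.realize ![x, y, y] = x ∧ q.realize ![y, y, x] = x

end Commutator

end UnivAlg

namespace UnivAlg

open FirstOrder FirstOrder.Language

/-! ### Lengths of terms under substitution -/

section TermLength

variable {L : FirstOrder.Language.{u, v}} {X Y : Type*}

/-! Let the degree be `d`. Fix one variable `o`, split the variables into `d + 1` blocks of about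
equal size, and let `g i` replace block `i` by `o`. Taking Mal'cev differences `q(f(v), f(v ∘ g i),
v o)` for all `i` in turn makes any term function absorbing in every block, so supernilpotency
forces the result to be `v o` (`realize_eq_of_absorbs`). Differences can be undone: `x ↦ q(x, y, z)`
is a permutation, and by finiteness a single term `r` inverts all of them
(`exists_inverse_translation`). Hence a term function is rebuilt, with a constant number of nested
uses of `q` and `r`, from `o` and minors that lack a whole block. This gives `Len (m + 1) ≤ C * Len
(m + 1 - m / (d + 1))` (`exists_Len_le_mul`): shrinking the arity by a constant factor costs a
constant factor in length, so the growth is polynomial. -/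

theorem one_le_termLength (t : L.Term X) : 1 ≤ termLength t := by
  cases t <;> simp [termLength]

theorem termLength_relabel (g : X → Y) (t : L.Term X) :
    termLength (t.relabel g) = termLength t := by
  induction t with
  | var => rfl
  | func f ts ih => simp [termLength, ih]

theorem termLength_subst_le (t : L.Term X) (σ : X → L.Term Y) {M : ℕ} (hM : 1 ≤ M)
    (hσ : ∀ i, termLength (σ i) ≤ M) : termLength (t.subst σ) ≤ termLength t * M := by
  induction t with
  | var i => simpa [termLength] using hσ i
  | func f ts ih =>
    simp only [Term.subst, termLength, add_mul, one_mul, Finset.sum_mul]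
    exact Nat.add_le_add hM (Finset.sum_le_sum fun i _ => ih i)

end TermLength

/-! ### Short representations of term functions and of their minors -/

section Representation

variable (L : FirstOrder.Language.{u, v}) {A : Type w} [L.Structure A] {X : Type*}

/-- The function `f` is induced by a term of length at most `M`. -/
def HasLengthLE (f : (X → A) → A) (M : ℕ) : Prop :=
  ∃ s : L.Term X, (∀ v, s.realize v = f v) ∧ termLength s ≤ M

variable {L}

theorem HasLengthLE.mono {f : (X → A) → A} {M N : ℕ} (h : HasLengthLE L f M) (hMN : M ≤ N) :
    HasLengthLE L f N := by
  obtain ⟨s, hs, hl⟩ := h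
  exact ⟨s, hs, hl.trans hMN⟩

theorem hasLengthLE_var (x : X) : HasLengthLE L (fun v : X → A => v x) 1 :=
  ⟨.var x, fun _ => rfl, le_rfl⟩

theorem HasLengthLE.comp {k : ℕ} (p : L.Term (Fin k)) {f : Fin k → (X → A) → A} {M : ℕ}
    (hM : 1 ≤ M) (hf : ∀ i, HasLengthLE L (f i) M) :
    HasLengthLE L (fun v => p.realize fun i => f i v) (termLength p * M) := by
  choose s hs hl using hf
  exact ⟨p.subst s, fun v => by simp [Term.realize_subst, hs],
    termLength_subst_le p s hM hl⟩

theorem HasLengthLE.comp₃ (p : L.Term (Fin 3)) {f g h : (X → A) → A} {M : ℕ} (hM : 1 ≤ M)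
    (hf : HasLengthLE L f M) (hg : HasLengthLE L g M) (hh : HasLengthLE L h M) :
    HasLengthLE L (fun v => p.realize ![f v, g v, h v]) (termLength p * M) := by
  have h3 : ∀ i, HasLengthLE L (![f, g, h] i) M := by
    intro i; fin_cases i <;> assumption
  convert HasLengthLE.comp p hM h3 using 3 with v
  ext i; fin_cases i <;> rfl

theorem Len_le {n M : ℕ} (hn : 0 < n) [Finite A]
    (h : ∀ t : L.Term (Fin n), HasLengthLE L (fun v : Fin n → A => t.realize v) M) :
    Len L A n ≤ M := by
  obtain ⟨t, ht⟩ := (Len_isGreatest L A hn).1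
  obtain ⟨s, hs, hl⟩ := h t
  rw [← ht]
  exact ((funLength_isLeast L A t).2 ⟨s, funext hs, rfl⟩).trans hl

theorem hasLengthLE_Len {n : ℕ} (hn : 0 < n) [Finite A] (t : L.Term (Fin n)) :
    HasLengthLE L (fun v : Fin n → A => t.realize v) (Len L A n) := by
  obtain ⟨s, hs, hl⟩ := (funLength_isLeast L A t).1
  exact ⟨s, fun v => congrFun hs v, hl ▸ (Len_isGreatest L A hn).2 ⟨t, rfl⟩⟩

theorem one_le_Len {n : ℕ} (hn : 0 < n) [Finite A] : 1 ≤ Len L A n := by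
  obtain ⟨s, -, hl⟩ := hasLengthLE_Len (A := A) hn (.var ⟨0, hn⟩ : L.Term (Fin n))
  exact (one_le_termLength s).trans hl

/-- A minor of a term function with at most `n` distinct variables has length at most `Len n`. -/
theorem hasLengthLE_Len_of_ncard_range_le [Finite A] [Finite X] [Nonempty X] {n : ℕ} {g : X → X}
    (hg : (Set.range g).ncard ≤ n) (t : L.Term X) :
    HasLengthLE L (fun v : X → A => t.realize (v ∘ g)) (Len L A n) := by
  have hpos : 0 < n := (Set.ncard_pos (Set.toFinite _)|>.2 (Set.range_nonempty g)).trans_le hg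
  have hcard : Nat.card (Set.range g) ≤ Nat.card (Fin n) := by simpa using hg
  obtain ⟨e⟩ : Nonempty (Set.range g ↪ Fin n) := by
    have := Fintype.ofFinite (Set.range g)
    exact Function.Embedding.nonempty_of_card_le
      (by simpa only [Nat.card_eq_fintype_card] using hcard)
  let π : X → Fin n := fun x => e ⟨g x, x, rfl⟩
  have : Nonempty (Set.range g) := (Set.range_nonempty g).to_subtype
  -- `g` factors as `ι ∘ π` through `Fin n`; values of `ι` outside the range of `e` are arbitrary
  -- and play no role.
  let ι : Fin n → X := fun i => (Function.invFun e i : Set.range g)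
  have hι : ι ∘ π = g := by
    ext x
    simp [ι, π, Function.leftInverse_invFun e.injective _]
  obtain ⟨s, hs, hl⟩ := hasLengthLE_Len (A := A) hpos (t.relabel π)
  refine ⟨s.relabel ι, fun v => ?_, by rwa [termLength_relabel]⟩
  rw [Term.realize_relabel, hs]
  dsimp only
  rw [Term.realize_relabel, Function.comp_assoc, hι]

end Representation

/-! ### Translations of a supernilpotent Mal'cev algebra are uniformly invertible -/

section Malcev

variable {L : FirstOrder.Language.{u, v}} {A : Type w} [L.Structure A]

theorem IsSupernilpotentOfDegree.centralizes {d : ℕ} (h : IsSupernilpotentOfDegree L A d) :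
    Centralizes (fun _ : Fin (d + 1) => oneCong L A) (zeroCong L A) :=
  h ▸ centralizes_commutator _

/-- The term `q(… q(q(x, y₁, z₁), y₂, z₂) …)`, where `yᵢ` and `zᵢ` are the variables of block `i`
and `x` is a variable of the last block. -/
def iteratedTranslation (q : L.Term (Fin 3)) {d : ℕ} (l : List (Fin d)) :
    L.Term (Σ _ : Fin (d + 1), Fin 2) :=
  l.foldr (fun j t => q.subst ![t, .var ⟨j.castSucc, 1⟩, .var ⟨j.castSucc, 0⟩])
    (.var ⟨Fin.last d, 0⟩)

theorem realize_subst₃ {X : Type*} (q : L.Term (Fin 3)) (r s t : L.Term X) (v : X → A) :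
    (q.subst ![r, s, t]).realize v = q.realize ![r.realize v, s.realize v, t.realize v] := by
  rw [Term.realize_subst]
  congr 1
  ext i; fin_cases i <;> rfl

/-- In a supernilpotent Mal'cev algebra, `x ↦ q(x, y, z)` is injective. -/
theorem injective_translation {d : ℕ} (hA : IsSupernilpotentOfDegree L A d) {q : L.Term (Fin 3)}
    (hq : ∀ x y : A, q.realize ![x, y, y] = x) (y z : A) :
    Function.Injective fun x => q.realize ![x, y, z] := by
  intro x x' hxx
  -- Choosing `b` in block `j < d` makes the `j`-th factor `q(·, y, y)`, the identity; choosing `a`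
  -- makes it `q(·, y, z)`. The last block switches between `x` and `x'`.
  let a : (i : Fin (d + 1)) → Fin 2 → A := fun i => ![Fin.lastCases x (fun _ => z) i, y]
  let b : (i : Fin (d + 1)) → Fin 2 → A := fun i => ![Fin.lastCases x' (fun _ => y) i, y]
  let m : (Fin d → Bool) → Bool → (Σ _ : Fin (d + 1), Fin 2) → A := fun s r =>
    mix (k := fun _ => 2) a b (Fin.snoc (α := fun _ => Bool) s r)
  have cons_eq : ∀ (j : Fin d) (l : List (Fin d)) (s : Fin d → Bool) (r : Bool),
      (iteratedTranslation q (j :: l)).realize (m s r) =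
        q.realize ![(iteratedTranslation q l).realize (m s r), y, if s j then y else z] := by
    intro j l s r
    rw [iteratedTranslation, List.foldr_cons, realize_subst₃]
    simp [m, a, b, mix, iteratedTranslation]
  have nil_eq : ∀ (s : Fin d → Bool) (r : Bool),
      (iteratedTranslation q []).realize (m s r) = if r then x' else x := by
    intro s r
    simp [m, a, b, mix, iteratedTranslation]
  have all_true : ∀ (l : List (Fin d)) (s : Fin d → Bool) (r : Bool), (∀ j ∈ l, s j = true) →
      (iteratedTranslation q l).realize (m s r) = if r then x' else x := by
    intro l s r
    induction l with
    | nil => exact fun _ => nil_eq s r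
    | cons j l ih =>
      intro h
      rw [cons_eq, ih fun i hi => h i (List.mem_cons_of_mem _ hi), h j List.mem_cons_self,
        if_pos rfl, hq]
  -- Inside the innermost false factor all factors are identities, so that factor receives `x` or
  -- `x'` and merges them by `hxx`.
  have some_false : ∀ (l : List (Fin d)) (s : Fin d → Bool), (∃ j ∈ l, s j = false) →
      (iteratedTranslation q l).realize (m s false) =
        (iteratedTranslation q l).realize (m s true) := by
    intro l s
    induction l with
    | nil => simp
    | cons j l ih =>
      intro h
      rw [cons_eq, cons_eq]
      by_cases hl : ∃ j ∈ l, s j = false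
      · rw [ih hl]
      · have hl' : ∀ j ∈ l, s j = true := by simpa using hl
        have hj : s j = false := by
          obtain ⟨i, hi, hs⟩ := h
          rcases List.mem_cons.1 hi with rfl | hi
          · exact hs
          · exact absurd ⟨i, hi, hs⟩ hl
        rw [all_true l s _ hl', all_true l s _ hl', hj]
        simpa using hxx
  have key := hA.centralizes (fun _ => 2) (iteratedTranslation q (List.finRange d)) a b
    (fun _ _ => trivial) fun s hs => some_false _ s (by
      by_contra h
      push Not at h
      exact hs (funext fun j => by simpa using h j (List.mem_finRange j)))
  have e₁ := all_true (List.finRange d) (fun _ => true) false fun _ _ => rfl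
  have e₂ := all_true (List.finRange d) (fun _ => true) true fun _ _ => rfl
  simpa using e₁.symm.trans (Eq.trans key e₂)

/-- A finite supernilpotent Mal'cev algebra has a term inverting all translations
`x ↦ q(x, y, z)`. -/
theorem exists_inverse_translation [Finite A] {d : ℕ} (hA : IsSupernilpotentOfDegree L A d)
    {q : L.Term (Fin 3)} (hq : ∀ x y : A, q.realize ![x, y, y] = x) :
    ∃ r : L.Term (Fin 3), ∀ x y z : A, r.realize ![q.realize ![x, y, z], y, z] = x := by
  have iter : ∀ n : ℕ, ∃ r : L.Term (Fin 3), ∀ x y z : A,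
      r.realize ![x, y, z] = (fun x => q.realize ![x, y, z])^[n] x := by
    intro n
    induction n with
    | zero => exact ⟨.var 0, fun _ _ _ => rfl⟩
    | succ n ih =>
      obtain ⟨r, hr⟩ := ih
      refine ⟨q.subst ![r, .var 1, .var 2], fun x y z => ?_⟩
      rw [realize_subst₃, Function.iterate_succ_apply', hr]
      rfl
  -- By Lagrange, this power inverts every permutation of `A`, so one exponent serves all `y`, `z`.
  obtain ⟨r, hr⟩ := iter (Nat.card (Equiv.Perm A) - 1)
  refine ⟨r, fun x y z => ?_⟩
  let σ : Equiv.Perm A :=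
    Equiv.ofBijective _ (Finite.injective_iff_bijective.1 (injective_translation hA hq y z))
  rw [hr]
  change (⇑σ)^[Nat.card (Equiv.Perm A) - 1] (σ x) = x
  rw [← Function.iterate_succ_apply, Nat.succ_eq_add_one, Nat.sub_add_cancel Nat.card_pos,
    ← Equiv.Perm.coe_pow, pow_card_eq_one', Equiv.Perm.one_apply]

end Malcev

/-! ### Iterated differences, absorption and reconstruction -/

section Difference

variable {L : FirstOrder.Language.{u, v}} {A : Type w} [L.Structure A] {X : Type*}

/-- The difference `q(f(v), f(v ∘ g), v o)` of `f` and its minor along `g`, taken with respect to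
the variable `o`, and iterated along a list of maps `g`. -/
def iteratedDiff (q : L.Term (Fin 3)) (o : X) : List (X → X) → ((X → A) → A) → (X → A) → A
  | [], f => f
  | g :: l, f => iteratedDiff q o l fun v => q.realize ![f v, f (v ∘ g), v o]

theorem exists_realize_iteratedDiff (q : L.Term (Fin 3)) (o : X) (l : List (X → X))
    (t : L.Term X) : ∃ s : L.Term X, ∀ v : X → A,
      s.realize v = iteratedDiff q o l (fun v => t.realize v) v := by
  induction l generalizing t with
  | nil => exact ⟨t, fun _ => rfl⟩
  | cons g l ih =>
    obtain ⟨s, hs⟩ := ih (q.subst ![t, t.relabel g, .var o])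
    refine ⟨s, fun v => ?_⟩
    rw [hs, iteratedDiff]
    congr 1
    ext v
    rw [realize_subst₃, Term.realize_relabel, Term.realize_var]

/-- Later differences preserve absorption along `g`: since `g` commutes with `h` and both fix `o`,
substituting `v ∘ g` turns all three arguments of `q` into `v o`. -/
theorem iteratedDiff_absorbs {q : L.Term (Fin 3)} (hq : ∀ x y : A, q.realize ![y, y, x] = x)
    {o : X} {l : List (X → X)} {f : (X → A) → A} {g : X → X} (hg : g o = o)
    (hf : ∀ v, f (v ∘ g) = v o) (hl : ∀ h ∈ l, h o = o ∧ g ∘ h = h ∘ g) (v : X → A) :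
    iteratedDiff q o l f (v ∘ g) = v o := by
  induction l generalizing f with
  | nil => exact hf v
  | cons h l ih =>
    rw [iteratedDiff]
    refine ih (fun v => ?_) fun h' hh' => hl h' (List.mem_cons_of_mem _ hh')
    obtain ⟨ho, hc⟩ := hl h List.mem_cons_self
    rw [hf, Function.comp_assoc, hc, ← Function.comp_assoc, hf, Function.comp_apply,
      Function.comp_apply, ho, hg, hq]

/-- The difference along `g` itself creates absorption: at `v ∘ g`, idempotence makes the first two
arguments of `q` equal, leaving `v o`. The remaining differences keep it by `iteratedDiff_absorbs`.
-/
theorem iteratedDiff_absorbs_of_mem {q : L.Term (Fin 3)}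
    (hq : ∀ x y : A, q.realize ![y, y, x] = x) {o : X} {l : List (X → X)}
    (hl : ∀ g ∈ l, g o = o ∧ ∀ h ∈ l, g ∘ h = h ∘ g) (hidem : ∀ g ∈ l, g ∘ g = g)
    (f : (X → A) → A) {g : X → X} (hg : g ∈ l) (v : X → A) :
    iteratedDiff q o l f (v ∘ g) = v o := by
  induction l generalizing f with
  | nil => simp at hg
  | cons h l ih =>
    rw [iteratedDiff]
    rcases List.mem_cons.1 hg with rfl | hgl
    · refine iteratedDiff_absorbs hq (hl g List.mem_cons_self).1 (fun v => ?_) (fun h hh => ?_) v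
      · rw [Function.comp_assoc, hidem g List.mem_cons_self, Function.comp_apply,
          (hl g List.mem_cons_self).1, hq]
      · exact ⟨(hl h (List.mem_cons_of_mem _ hh)).1,
          (hl g List.mem_cons_self).2 h (List.mem_cons_of_mem _ hh)⟩
    · exact ih (fun g hg => ⟨(hl g (List.mem_cons_of_mem _ hg)).1, fun h hh =>
        (hl g (List.mem_cons_of_mem _ hg)).2 h (List.mem_cons_of_mem _ hh)⟩)
        (fun g hg => hidem g (List.mem_cons_of_mem _ hg)) _ hgl

/-- If the iterated difference of `f` vanishes, then `f` can be recovered from its minors. -/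
theorem hasLengthLE_of_iteratedDiff {q r : L.Term (Fin 3)}
    (hr : ∀ x y z : A, r.realize ![q.realize ![x, y, z], y, z] = x) {o : X}
    {G : Set (X → X)} (hGo : ∀ g ∈ G, g o = o) (hG : ∀ g ∈ G, ∀ h ∈ G, g ∘ h ∈ G)
    {l : List (X → X)} (hl : ∀ g ∈ l, g ∈ G) {f : (X → A) → A} {M : ℕ} (hM : 1 ≤ M)
    (hf : ∀ g ∈ G, HasLengthLE L (fun v => f (v ∘ g)) M)
    (h0 : ∀ v, iteratedDiff q o l f v = v o) :
    HasLengthLE L f ((termLength r * termLength q) ^ l.length * M) := by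
  induction l generalizing f M with
  | nil =>
    have : f = fun v => v o := funext h0
    rw [this]
    exact (hasLengthLE_var o).mono (by simpa using hM)
  | cons h l ih =>
    have hh : h ∈ G := hl h List.mem_cons_self
    have hqM : M ≤ termLength q * M := Nat.le_mul_of_pos_left _ (one_le_termLength q)
    have hN : termLength q * M ≤
        (termLength r * termLength q) ^ l.length * (termLength q * M) :=
      Nat.le_mul_of_pos_left _
        (Nat.pow_pos (Nat.mul_pos (one_le_termLength r) (one_le_termLength q)))
    -- The minor along `g` of the first difference is built by `q` from the minors of `f` along `g`
    -- and `g ∘ h`, whence the bound `termLength q * M`. Afterwards `r` recovers `f` from this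
    -- difference, the minor along `h`, and `v o`.
    have hD := ih (fun g hg => hl g (List.mem_cons_of_mem _ hg)) (hM.trans hqM) (fun g hg => by
      have := HasLengthLE.comp₃ q hM (hf g hg) (hf _ (hG g hg h hh))
        ((hasLengthLE_var o).mono hM)
      simpa only [Function.comp_apply, hGo g hg, Function.comp_assoc] using this) h0
    have := HasLengthLE.comp₃ r (hM.trans (hqM.trans hN)) hD ((hf h hh).mono (hqM.trans hN))
      ((hasLengthLE_var o).mono (hM.trans (hqM.trans hN)))
    simp only [hr] at this
    refine this.mono (le_of_eq ?_)
    rw [List.length_cons]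
    ring

/-- A term function that is absorbing in `d + 1` blocks of variables vanishes in a supernilpotent
algebra of degree `d`. -/
theorem realize_eq_of_absorbs {d N : ℕ} (hA : IsSupernilpotentOfDegree L A d)
    (β : Fin N → Fin (d + 1)) (o : Fin N) (t : L.Term (Fin N))
    (ht : ∀ i (v : Fin N → A), t.realize (v ∘ fun x => if β x = i then o else x) = v o)
    (v : Fin N → A) : t.realize v = v o := by
  -- Variable `x` is placed in block `β x`; a false choice replaces the whole block by the constant
  -- `v o`.
  have hval : ∀ s : Fin (d + 1) → Bool,
      (t.relabel fun x => (⟨β x, x⟩ : Σ _ : Fin (d + 1), Fin N)).realize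
        (mix (k := fun _ => N) (fun _ _ => v o) (fun _ => v) s) =
      t.realize fun x => if s (β x) then v x else v o := by
    intro s
    rw [Term.realize_relabel]
    rfl
  have hfalse : ∀ (s : Fin (d + 1) → Bool) (i), s i = false →
      (t.realize fun x => if s (β x) then v x else v o) = v o := by
    intro s i hi
    convert ht i (fun x => if s (β x) then v x else v o) using 2
    · ext x
      by_cases hx : β x = i <;> simp [hx, hi]
    · simp
  have key := hA.centralizes (fun _ => N) (t.relabel fun x => ⟨β x, x⟩)
    (fun _ _ => v o) (fun _ => v) (fun _ _ => trivial) (fun s hs => by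
      obtain ⟨j, hj⟩ : ∃ j, s j = false := by
        by_contra h
        push Not at h
        exact hs (funext fun j => by simpa using h j)
      rw [hval, hval, hfalse _ j.castSucc (by simpa using hj),
        hfalse _ j.castSucc (by simpa using hj)])
  -- On the left the last block is false, so that side is `v o` by absorption; the right side is the
  -- all-true choice, `t` at `v`.
  rw [hval, hval, hfalse _ (Fin.last d) (by simp)] at key
  have hs : (Fin.snoc (α := fun _ => Bool) (fun _ : Fin d => true) true) = fun _ => true := by
    ext i
    refine Fin.lastCases ?_ (fun j => ?_) i <;> simp
  rw [hs] at key
  simpa using (Eq.symm key : _ = v o)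

end Difference

/-! ### The recursion for `Len` and its polynomial solution -/

section Bound

variable {L : FirstOrder.Language.{u, v}} {A : Type w} [L.Structure A]

theorem ncard_range_collapse_le {d m : ℕ} (i : Fin (d + 1)) :
    (Set.range fun x : Fin (m + 1) =>
      if Fin.ofNat (d + 1) x.val = i then (0 : Fin (m + 1)) else x).ncard ≤
        m + 1 - m / (d + 1) := by
  set r := m / (d + 1)
  -- `c` is the least positive index in block `i`. Positivity matters: variable `0` survives the
  -- collapse, while the `r` indices `c + (d + 1) * j` are lost.
  obtain ⟨c, hc0, hc, hci⟩ : ∃ c, 0 < c ∧ c ≤ d + 1 ∧ Fin.ofNat (d + 1) c = i := by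
    rcases Nat.eq_zero_or_pos i.val with h | h
    · exact ⟨d + 1, d.succ_pos, le_rfl, Fin.ext (by simp [h])⟩
    · exact ⟨i, h, i.2.le, Fin.ext (by simp)⟩
  have hlt : ∀ j : Fin r, c + (d + 1) * j.val < m + 1 := by
    intro j
    have h1 := Nat.mul_le_mul_left (d + 1) (Nat.succ_le_of_lt j.2)
    have h2 : (d + 1) * r ≤ m := Nat.mul_div_le m (d + 1)
    rw [Nat.succ_eq_add_one, mul_add] at h1
    omega
  let e : Fin r → Fin (m + 1) := fun j => ⟨c + (d + 1) * j.val, hlt j⟩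
  have he : Function.Injective e := fun j j' h => by
    simpa [e, Fin.ext_iff] using h
  have hcard : (Set.range e).ncard = r := by
    rw [← Nat.card_coe_set_eq, Nat.card_range_of_injective he, Nat.card_fin]
  have hsub : (Set.range fun x : Fin (m + 1) =>
      if Fin.ofNat (d + 1) x.val = i then (0 : Fin (m + 1)) else x) ⊆ (Set.range e)ᶜ := by
    rintro _ ⟨x, rfl⟩ ⟨j, hj⟩
    have hβ : Fin.ofNat (d + 1) (e j).val = i := by
      rw [← hci]
      exact Fin.ext (by simp [e])
    dsimp only at hj
    split_ifs at hj with hx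
    · have : (e j).val = 0 := by rw [hj]; rfl
      simp only [e] at this
      omega
    · exact hx (hj ▸ hβ)
  have h1 := Set.ncard_le_ncard hsub (Set.toFinite _)
  have h2 := Set.ncard_add_ncard_compl (Set.range e)
  rw [Nat.card_fin] at h2
  omega

theorem exists_Len_le_mul [Finite A] {d : ℕ} (hA : IsSupernilpotentOfDegree L A d)
    (hm : IsMalcev L A) :
    ∃ C : ℕ, ∀ m : ℕ, Len L A (m + 1) ≤ C * Len L A (m - m / (d + 1) + 1) := by
  obtain ⟨q, hq⟩ := hm
  obtain ⟨r, hr⟩ := exists_inverse_translation hA fun x y => (hq x y).1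
  refine ⟨(termLength r * termLength q) ^ (d + 1), fun m => Len_le m.succ_pos fun t => ?_⟩
  let β : Fin (m + 1) → Fin (d + 1) := fun x => Fin.ofNat (d + 1) x.val
  let g : Fin (d + 1) → Fin (m + 1) → Fin (m + 1) := fun i x => if β x = i then 0 else x
  have hg0 : ∀ i, g i 0 = 0 := fun i => by simp [g]
  have hgeq : ∀ i x, β x = i → g i x = 0 := fun i x h => if_pos h
  have hgne : ∀ i x, β x ≠ i → g i x = x := fun i x h => if_neg h
  have hcomm : ∀ i j, g i ∘ g j = g j ∘ g i := by
    intro i j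
    ext x : 1
    by_cases hi : β x = i <;> by_cases hj : β x = j <;>
      first
        | simp only [Function.comp_apply, hg0, hgeq _ _ hi, hgeq _ _ hj]
        | simp only [Function.comp_apply, hg0, hgeq _ _ hi, hgne _ _ hj]
        | simp only [Function.comp_apply, hg0, hgne _ _ hi, hgeq _ _ hj]
        | simp only [Function.comp_apply, hgne _ _ hi, hgne _ _ hj]
  have hidem : ∀ i, g i ∘ g i = g i := by
    intro i
    ext x : 1
    by_cases hi : β x = i
    · simp only [Function.comp_apply, hg0, hgeq _ _ hi]
    · simp only [Function.comp_apply, hgne _ _ hi]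
  let l : List (Fin (m + 1) → Fin (m + 1)) := List.ofFn g
  have habs : ∀ i (f : (Fin (m + 1) → A) → A) (v : Fin (m + 1) → A),
      iteratedDiff q 0 l f (v ∘ g i) = v 0 := by
    intro i f v
    refine iteratedDiff_absorbs_of_mem (fun x y => (hq x y).2) ?_ ?_ f
      (List.mem_ofFn.2 ⟨i, rfl⟩) v
    · simp only [List.mem_ofFn]
      rintro _ ⟨i, rfl⟩
      refine ⟨hg0 i, ?_⟩
      rintro _ ⟨j, rfl⟩
      exact hcomm i j
    · simp only [List.mem_ofFn]
      rintro _ ⟨i, rfl⟩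
      exact hidem i
  obtain ⟨s, hs⟩ := exists_realize_iteratedDiff (A := A) q 0 l t
  have hzero : ∀ v, iteratedDiff q 0 l (fun v : Fin (m + 1) → A => t.realize v) v = v 0 := by
    intro v
    rw [← hs]
    exact realize_eq_of_absorbs hA β 0 s (fun i v => by rw [hs]; exact habs i _ v) v
  have := hasLengthLE_of_iteratedDiff hr
    -- Composition cannot enlarge the range of the outer map, so this set is closed under
    -- composition.
    (G := {h | h 0 = 0 ∧ (Set.range h).ncard ≤ m - m / (d + 1) + 1}) (fun _ h => h.1)
    (fun h hh h' hh' => ⟨by simp [hh.1, hh'.1],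
      (Set.ncard_le_ncard (Set.range_comp_subset_range h' h) (Set.toFinite _)).trans hh.2⟩)
    (l := l) (by
      simp only [l, List.mem_ofFn]
      rintro _ ⟨i, rfl⟩
      refine ⟨hg0 i, ?_⟩
      have := Nat.div_le_self m (d + 1)
      have := ncard_range_collapse_le (m := m) i
      change (Set.range (g i)).ncard ≤ _ at this
      omega)
    (one_le_Len (L := L) (A := A) (n := m - m / (d + 1) + 1) (Nat.succ_pos _))
    (fun h hh => hasLengthLE_Len_of_ncard_range_le hh.2 t) hzero
  simpa [l] using this

theorem exists_pow_bound_of_le_mul {u : ℕ → ℕ} {C d : ℕ}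
    (hu : ∀ m, u m ≤ C * u (m - m / (d + 1))) :
    ∃ k : ℕ, 0 < k ∧ ∃ c : ℝ, 0 < c ∧ ∀ m : ℕ, (u m : ℝ) ≤ c * ((m + 1 : ℕ) : ℝ) ^ k := by
  have hd : (0 : ℝ) < 2 * (d + 1) := by positivity
  -- For `m ≥ d + 1` the quotient `m / (d + 1)` is at least `(m + 1) / (2 * (d + 1))` despite
  -- rounding, so `m + 1` shrinks by the factor `ρ`.
  set ρ : ℝ := 1 - 1 / (2 * (d + 1)) with hρ
  have hρ1 : ρ < 1 := sub_lt_self _ (by positivity)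
  have hρ0 : 0 ≤ ρ := by
    rw [hρ, sub_nonneg, div_le_one hd]
    have : (0 : ℝ) ≤ d := d.cast_nonneg
    linarith
  -- The exponent is chosen so that the gain from `ρ` cancels `C`; using `C + 1` covers `C = 0`.
  obtain ⟨k, hk⟩ := exists_pow_lt_of_lt_one (show (0 : ℝ) < 1 / (C + 1) by positivity) hρ1
  have hCk : (C : ℝ) * ρ ^ (k + 1) ≤ 1 := by
    have h1 : ρ ^ (k + 1) ≤ 1 / (C + 1) :=
      (pow_le_pow_of_le_one hρ0 hρ1.le k.le_succ).trans hk.le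
    calc (C : ℝ) * ρ ^ (k + 1) ≤ C * (1 / (C + 1)) := by gcongr
      _ ≤ 1 := by rw [mul_one_div, div_le_one (by positivity)]; linarith
  -- The sum dominates the values with `m ≤ d`, where the recursion gives no decrease.
  refine ⟨k + 1, k.succ_pos, 1 + ∑ m ∈ Finset.range (d + 1), (u m : ℝ), by positivity, ?_⟩
  intro m
  induction m using Nat.strong_induction_on with
  | _ m ih =>
    set c : ℝ := 1 + ∑ m ∈ Finset.range (d + 1), (u m : ℝ)
    have hc : 0 ≤ c := by positivity
    rcases lt_or_ge m (d + 1) with hm | hm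
    · have h1 : (u m : ℝ) ≤ c := by
        have := Finset.single_le_sum (f := fun m => (u m : ℝ)) (fun i _ => (u i).cast_nonneg)
          (Finset.mem_range.2 hm)
        simp only [c]
        linarith
      exact h1.trans (le_mul_of_one_le_right hc (one_le_pow₀ (by simp)))
    · have hpos : 0 < m / (d + 1) := Nat.div_pos hm d.succ_pos
      have hle : m / (d + 1) ≤ m := Nat.div_le_self _ _
      have hq : m + 1 ≤ 2 * (d + 1) * (m / (d + 1)) := by
        have h1 := Nat.div_add_mod m (d + 1)
        have h2 : m % (d + 1) < d + 1 := Nat.mod_lt m d.succ_pos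
        have h3 := Nat.le_mul_of_pos_right (d + 1) hpos
        rw [mul_assoc]
        omega
      have hstep : ((m - m / (d + 1) + 1 : ℕ) : ℝ) ≤ ρ * ((m + 1 : ℕ) : ℝ) := by
        have h1 : ((m + 1 : ℕ) : ℝ) / (2 * (d + 1)) ≤ (m / (d + 1) : ℕ) := by
          rw [div_le_iff₀ hd, mul_comm]
          exact_mod_cast hq
        have h2 : ((m - m / (d + 1) + 1 : ℕ) : ℝ) = (m + 1 : ℕ) - (m / (d + 1) : ℕ) := by
          rw [Nat.cast_add, Nat.cast_sub hle]
          push_cast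
          ring
        rw [h2, hρ, sub_mul, one_mul, one_div_mul_eq_div]
        linarith
      calc (u m : ℝ) ≤ C * u (m - m / (d + 1)) := by exact_mod_cast hu m
        _ ≤ C * (c * ((m - m / (d + 1) + 1 : ℕ) : ℝ) ^ (k + 1)) := by
          gcongr
          exact ih _ (by omega)
        _ ≤ C * (c * (ρ * ((m + 1 : ℕ) : ℝ)) ^ (k + 1)) := by gcongr
        _ = (C * ρ ^ (k + 1)) * (c * ((m + 1 : ℕ) : ℝ) ^ (k + 1)) := by rw [mul_pow]; ring
        _ ≤ c * ((m + 1 : ℕ) : ℝ) ^ (k + 1) := mul_le_of_le_one_left (by positivity) hCk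

end Bound

end UnivAlg

theorem mainTheorem9 {L : FirstOrder.Language.{u, v}} [L.IsAlgebraic] {A : Type w}
    [L.Structure A] [Nonempty A] [Finite A]
    (hsn : UnivAlg.IsSupernilpotent L A) (hm : UnivAlg.IsMalcev L A) :
    ∃ k : ℕ, 0 < k ∧ ∃ c : ℝ, 0 < c ∧
      ∀ n : ℕ, 0 < n → (UnivAlg.Len L A n : ℝ) ≤ c * (n : ℝ) ^ k := by
  obtain ⟨d, -, hd⟩ := hsn
  obtain ⟨C, hC⟩ := UnivAlg.exists_Len_le_mul hd hm
  obtain ⟨k, hk, c, hc, h⟩ :=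
    UnivAlg.exists_pow_bound_of_le_mul (u := fun m => UnivAlg.Len L A (m + 1)) hC
  refine ⟨k, hk, c, hc, fun n hn => ?_⟩
  obtain ⟨m, rfl⟩ : ∃ m, n = m + 1 := ⟨n - 1, by omega⟩
  exact h m
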